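/- Let $n\ge 1$, $m\ge 0$, $s\ge 1$, $q\ge 0$ be integers, put $r=\left[\frac{s+1}{2}\right]$ (integer part), and let $X$ be a smooth manifold of dimension $N=n+m$. Let $P^s_nX$ be the Grassmann bundle of $s$-contact elements of $n$-dimensional submanifolds of $X$, i.e. the $s$-jets at $0$ of immersions of neighbourhoods of $0\in\mathbb R^n$ into $X$ modulo reparametrisation of the source, and let $\rho^{s,s-1}_n:P^s_nX\to P^{s-1}_nX$ be the canonical projection, where $P^0_nX=X$. A chart of $X$ whose coordinates are split into $(x^i,y^\sigma)$, $1\le i\le n$, $1\le\sigma\le m$, induces an adapted chart $(x^i,y^\sigma_I)_{|I|\le s}$ of $P^s_nX$ ($I$ a multi-index), in which one has the contact forms $\omega^\sigma_I=dy^\sigma_I-\sum_i y^\sigma_{iI}\,dx^i$, $|I|\le s-1$. Let $\Omega^{s,s}_{q+1,\xi}(X)$ be the set of smooth $(q+1)$-forms $\alpha$ on $P^s_nX$ such that $i_\xi\alpha=0$ for every $\rho^{s,s-1}_n$-vertical vector field $\xi$ and such that, in every adapted chart, $$\alpha=\sum_{k=0}^{q+1}\ \sum_{|I_1|,\dots,|I_k|\le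 s-1}T^{I_1,\dots,I_k}_{\sigma_1,\dots,\sigma_k,i_{k+1},\dots,i_{q+1}}\,\omega^{\sigma_1}_{I_1}\wedge\dots\wedge\omega^{\sigma_k}_{I_k}\wedge dx^{i_{k+1}}\wedge\dots\wedge dx^{i_{q+1}}$$ with smooth coefficients $T$ that are antisymmetric in the pairs $(I_a,\sigma_a)$ and antisymmetric in the indices $i_b$, and that vanish whenever $|I_1|+\dots+|I_k|\ge s$. Let $\alpha\in\Omega^{s,s}_{q+1,\xi}(X)$ be closed. Then in every adapted chart each point has an open neighbourhood $U$ on which $$\alpha=d\theta ,$$ where $\theta$ is a smooth $q$-form on $U$ that is $\rho^{s,s-1}_n$-projectable (it is the pull-back of a smooth $q$-form on $\rho^{s,s-1}_n(U)$) and has the expression $$\theta=\sum_{k=0}^{q}\ \sum_{|I_1|,\dots,|I_k|\le r-1}L^{I_1,\dots,I_k}_{\sigma_1,\dots,\sigma_k,i_{k+1},\dots,i_q}\,\omega^{\sigma_1}_{I_1}\wedge\dots\wedge\omega^{\sigma_k}_{I_k}\wedge dx^{i_{k+1}}\wedge\dots\wedge dx^{i_q}$$ with coefficients $L$ that are smooth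 functions on $U$ of the coordinates $(x^i,y^\sigma_J)_{|J|\le s}$, antisymmetric in the pairs $(I_a,\sigma_a)$ and antisymmetric in the indices $i_b$. -/

import Mathlib

open scoped Manifold ContDiff Topology

noncomputable section

namespace Grassmann

/-! ### Contact elements -/

/-- `γ` is a smooth immersion of a neighbourhood of `0 ∈ ℝⁿ` into the `(n+m)`-manifold `X`
(the values of `γ` away from `0` are irrelevant). -/
def IsImmersionAtZero (n m : ℕ) {X : Type*} [TopologicalSpace X]
    [ChartedSpace (EuclideanSpace ℝ (Fin (n + m))) X]
    (γ : EuclideanSpace ℝ (Fin n) → X) : Prop :=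
  ∃ U : Set (EuclideanSpace ℝ (Fin n)), IsOpen U ∧ (0 : EuclideanSpace ℝ (Fin n)) ∈ U ∧
    ContMDiffOn (𝓡 n) (𝓡 (n + m)) ∞ γ U ∧
    ∀ t ∈ U, Function.Injective (mfderiv (𝓡 n) (𝓡 (n + m)) γ t)

/-- `j₀ˢγ = j₀ˢδ`: in some chart of `X` the two maps have the same partial derivatives
up to order `s` at `0`. -/
def SameJet (n m s : ℕ) {X : Type*} [TopologicalSpace X]
    [ChartedSpace (EuclideanSpace ℝ (Fin (n + m))) X]
    (γ δ : EuclideanSpace ℝ (Fin n) → X) : Prop :=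
  γ 0 = δ 0 ∧ ∃ ψ ∈ IsManifold.maximalAtlas (𝓡 (n + m)) ∞ X, γ 0 ∈ ψ.source ∧
    ∀ k ≤ s, iteratedFDeriv ℝ k (fun t => ψ (γ t)) 0 = iteratedFDeriv ℝ k (fun t => ψ (δ t)) 0

/-- Two immersions define the same `s`-contact element iff their `s`-jets at `0` differ by the
action of the differential group, i.e. by the jet of a diffeomorphism of `ℝⁿ` fixing `0`. -/
def SameContact (n m s : ℕ) {X : Type*} [TopologicalSpace X]
    [ChartedSpace (EuclideanSpace ℝ (Fin (n + m))) X]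
    (γ δ : {γ : EuclideanSpace ℝ (Fin n) → X // IsImmersionAtZero n m γ}) : Prop :=
  ∃ a : Diffeomorph (𝓡 n) (𝓡 n) (EuclideanSpace ℝ (Fin n)) (EuclideanSpace ℝ (Fin n)) ∞,
    a 0 = 0 ∧ SameJet n m s (fun t => γ.1 (a t)) δ.1

/-- The points of the Grassmann bundle `PˢₙX`: the regular `(s,n)`-velocities modulo the
differential group. -/
def ContactElement (n m s : ℕ) (X : Type*) [TopologicalSpace X]
    [ChartedSpace (EuclideanSpace ℝ (Fin (n + m))) X] : Type _ :=
  Quot (SameContact n m s (X := X))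

/-- The canonical projection `ρ^{s,r} : PˢₙX → PʳₙX`, `[j₀ˢγ] ↦ [j₀ʳγ]`. -/
def ContactElement.proj {n m s r : ℕ} {X : Type*} [TopologicalSpace X]
    [ChartedSpace (EuclideanSpace ℝ (Fin (n + m))) X] (h : r ≤ s) :
    ContactElement n m s X → ContactElement n m r X :=
  Quot.map id fun _ _ ⟨a, ha, h0, ψ, hψ, hs, hk⟩ =>
    ⟨a, ha, h0, ψ, hψ, hs, fun k hkr => hk k (hkr.trans h)⟩

/-! ### The coordinate spaces -/

/-- Multi-indices `J = (J₁, …, Jₙ)` of length `|J| = ∑ Jᵢ ≤ s`. -/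
abbrev MultiIdx (n s : ℕ) : Type := {J : Fin n → ℕ // ∑ i, J i ≤ s}

instance (n s : ℕ) : Finite (MultiIdx n s) :=
  Finite.of_injective
    (fun J : MultiIdx n s => fun i : Fin n =>
      (⟨J.1 i, Nat.lt_succ_of_le
        ((Finset.single_le_sum (fun j _ => Nat.zero_le (J.1 j)) (Finset.mem_univ i)).trans
          J.2)⟩ : Fin (s + 1)))
    (fun _ _ h => Subtype.ext (funext fun i => congrArg Fin.val (congrFun h i)))

instance (n s : ℕ) : Fintype (MultiIdx n s) := Fintype.ofFinite _

/-- The multi-index of a sequence `(j₁, …, jₖ)`: the number of occurrences of each index. -/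
def countIdx {n k : ℕ} (j : Fin k → Fin n) : Fin n → ℕ :=
  fun i => (Finset.univ.filter fun a => j a = i).card

/-- The space of coordinates `(xⁱ, y^σ_J)`, `|J| ≤ s`, of an adapted chart of `PˢₙX`. -/
abbrev JetCoord (n m s : ℕ) : Type := (Fin n → ℝ) × (Fin m × MultiIdx n s → ℝ)

/-- The differential `dxⁱ` (which is also the coordinate function `xⁱ`). -/
def dx {n m s : ℕ} (i : Fin n) : JetCoord n m s →L[ℝ] ℝ :=
  (ContinuousLinearMap.proj i).comp (ContinuousLinearMap.fst ℝ _ _)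

/-- The differential `dy^σ_J` (which is also the coordinate function `y^σ_J`), for `|J| ≤ s`;
it is set to `0` for longer multi-indices, where it is never used. -/
def dy {n m s : ℕ} (σ : Fin m) (J : Fin n → ℕ) : JetCoord n m s →L[ℝ] ℝ :=
  if h : ∑ i, J i ≤ s then
    (ContinuousLinearMap.proj (σ, (⟨J, h⟩ : MultiIdx n s))).comp (ContinuousLinearMap.snd ℝ _ _)
  else 0

/-- The contact form `ω^σ_J = dy^σ_J - ∑ᵢ y^σ_{iJ} dxⁱ`, for `|J| ≤ s - 1`. -/
def contactForm {n m s : ℕ} (σ : Fin m) (J : Fin n → ℕ) (z : JetCoord n m s) :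
    JetCoord n m s →L[ℝ] ℝ :=
  dy σ J - ∑ i, (dy σ (J + Pi.single i 1) z) • dx i

/-- The truncation `(xⁱ, y^σ_J)_{|J| ≤ s} ↦ (xⁱ, y^σ_J)_{|J| ≤ r}`; it is the expression of
`ρ^{s,r}` in adapted charts, see `AdaptedChart.Represents.proj` below. -/
def trunc {n m s r : ℕ} (h : r ≤ s) : JetCoord n m s →L[ℝ] JetCoord n m r :=
  (ContinuousLinearMap.fst ℝ _ _).prod
    ((ContinuousLinearMap.pi fun a : Fin m × MultiIdx n r =>
      ContinuousLinearMap.proj (R := ℝ) (φ := fun _ : Fin m × MultiIdx n s => ℝ)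
        (a.1, (⟨a.2.1, a.2.2.trans h⟩ : MultiIdx n s))).comp (ContinuousLinearMap.snd ℝ _ _))

/-! ### Adapted charts of the Grassmann bundle -/

/-- An adapted chart: a smooth chart `ψ = (x^A)` of `X` with a splitting of the `n + m`
coordinates into `n` independent ones `xⁱ` and `m` dependent ones `y^σ`. -/
structure AdaptedChart (n m : ℕ) (X : Type*) [TopologicalSpace X]
    [ChartedSpace (EuclideanSpace ℝ (Fin (n + m))) X] where
  chart : OpenPartialHomeomorph X (EuclideanSpace ℝ (Fin (n + m)))
  mem_maximalAtlas : chart ∈ IsManifold.maximalAtlas (𝓡 (n + m)) ∞ X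
  split : Fin n ⊕ Fin m ≃ Fin (n + m)

/-- The coordinate `xⁱ` on `X`. -/
def AdaptedChart.x {n m : ℕ} {X : Type*} [TopologicalSpace X]
    [ChartedSpace (EuclideanSpace ℝ (Fin (n + m))) X] (c : AdaptedChart n m X)
    (i : Fin n) (p : X) : ℝ := c.chart p (c.split (Sum.inl i))

/-- The coordinate `y^σ` on `X`. -/
def AdaptedChart.y {n m : ℕ} {X : Type*} [TopologicalSpace X]
    [ChartedSpace (EuclideanSpace ℝ (Fin (n + m))) X] (c : AdaptedChart n m X)
    (σ : Fin m) (p : X) : ℝ := c.chart p (c.split (Sum.inr σ))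

/-- The image of the adapted chart of `PˢₙX` in its coordinate space: the point with coordinates
`(xⁱ, y^σ)` lies in the image of the chart of `X`, all the other coordinates are arbitrary. -/
def AdaptedChart.domain {n m : ℕ} {X : Type*} [TopologicalSpace X]
    [ChartedSpace (EuclideanSpace ℝ (Fin (n + m))) X] (c : AdaptedChart n m X) (s : ℕ) :
    Set (JetCoord n m s) :=
  {z | WithLp.toLp 2 (fun A => Sum.elim (fun i => dx i z) (fun σ => dy σ 0 z) (c.split.symm A))
    ∈ c.chart.target}

/-- `z = (xⁱ, y^σ_J)` are the coordinates of the contact element `p` in the chart `c`: one has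
`p = [j₀ˢγ]` where `γ` is parametrised by the independent coordinates, `xⁱ ∘ γ = xⁱ + tⁱ`, and
`y^σ_{j₁…jₖ} = ∂ᵏ(y^σ ∘ γ)/∂t^{j₁}…∂t^{jₖ} (0)` for `k ≤ s`. -/
def AdaptedChart.Represents {n m s : ℕ} {X : Type*} [TopologicalSpace X]
    [ChartedSpace (EuclideanSpace ℝ (Fin (n + m))) X] (c : AdaptedChart n m X)
    (z : JetCoord n m s) (p : ContactElement n m s X) : Prop :=
  ∃ γ : {γ : EuclideanSpace ℝ (Fin n) → X // IsImmersionAtZero n m γ},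
    (Quot.mk _ γ : ContactElement n m s X) = p ∧ γ.1 0 ∈ c.chart.source ∧
    (∀ᶠ t in 𝓝 (0 : EuclideanSpace ℝ (Fin n)), ∀ i, c.x i (γ.1 t) = dx i z + t i) ∧
    ∀ k ≤ s, ∀ (j : Fin k → Fin n) (σ : Fin m),
      iteratedFDeriv ℝ k (fun t => c.y σ (γ.1 t)) 0
        (fun a => EuclideanSpace.single (j a) (1 : ℝ)) = dy σ (countIdx j) z

theorem sum_countIdx {n k : ℕ} (j : Fin k → Fin n) : ∑ i, countIdx j i = k := by
  have h := Finset.card_eq_sum_card_fiberwise (f := j) (s := Finset.univ) (t := Finset.univ)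
    (fun _ _ => Finset.mem_coe.2 (Finset.mem_univ _))
  simpa [countIdx] using h.symm

/-- In adapted charts the canonical projection `ρ^{s,r}` is the truncation. -/
theorem AdaptedChart.Represents.proj {n m s r : ℕ} {X : Type*} [TopologicalSpace X]
    [ChartedSpace (EuclideanSpace ℝ (Fin (n + m))) X] {c : AdaptedChart n m X}
    {z : JetCoord n m s} {p : ContactElement n m s X} (hz : c.Represents z p) (h : r ≤ s) :
    c.Represents (trunc h z) (p.proj h) := by
  obtain ⟨γ, rfl, h0, hx, hy⟩ := hz
  refine ⟨γ, rfl, h0, hx, fun k hk j σ => ?_⟩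
  rw [hy k (hk.trans h) j σ]
  have h1 : ∑ i, countIdx j i ≤ s := (sum_countIdx j).le.trans (hk.trans h)
  have h2 : ∑ i, countIdx j i ≤ r := (sum_countIdx j).le.trans hk
  simp [dy, trunc, h1, h2]

/-! ### Differential forms on the Grassmann bundle -/

/-- A smooth differential `q`-form on `PˢₙX`: a smooth form on the image of every adapted chart,
such that these forms correspond to each other under pull-back by the changes of charts. -/
structure Form (n m s : ℕ) (X : Type*) [TopologicalSpace X]
    [ChartedSpace (EuclideanSpace ℝ (Fin (n + m))) X] (q : ℕ) where
  inChart : AdaptedChart n m X → JetCoord n m s → JetCoord n m s [⋀^Fin q]→L[ℝ] ℝ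
  smooth : ∀ c, ContDiffOn ℝ ∞ (inChart c) (c.domain s)
  compatible : ∀ (c c' : AdaptedChart n m X) (U : Set (JetCoord n m s))
    (τ : JetCoord n m s → JetCoord n m s), IsOpen U →
    (∀ z ∈ U, ∃ p : ContactElement n m s X, c.Represents z p ∧ c'.Represents (τ z) p) →
    ∀ z ∈ U, inChart c z = (inChart c' (τ z)).compContinuousLinearMap (fderiv ℝ τ z)

/-- `dα = 0`. -/
def Form.IsClosed {n m s : ℕ} {X : Type*} [TopologicalSpace X]
    [ChartedSpace (EuclideanSpace ℝ (Fin (n + m))) X] {q : ℕ} (α : Form n m s X q) : Prop :=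
  ∀ c : AdaptedChart n m X, ∀ z ∈ c.domain s, extDeriv (α.inChart c) z = 0

/-- The exterior product `ℓ₁ ∧ ⋯ ∧ ℓ_q` of linear forms,
`(v₁, …, v_q) ↦ ∑_P sign(P) ∏ ℓ_a(v_{P(a)}) = det (ℓ_a(v_b))`. -/
def wedge {E : Type*} [NormedAddCommGroup E] [NormedSpace ℝ E] {q : ℕ}
    (l : Fin q → E →L[ℝ] ℝ) : E [⋀^Fin q]→L[ℝ] ℝ :=
  ContinuousMultilinearMap.alternatization
    ((ContinuousMultilinearMap.mkPiAlgebra ℝ (Fin q) ℝ).compContinuousLinearMap l)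

/-- The form `ω^{σ₁}_{I₁} ∧ ⋯ ∧ ω^{σₖ}_{Iₖ} ∧ dx^{i_{k+1}} ∧ ⋯ ∧ dx^{i_q}` at the point `z`. -/
def contactMonomial {n m s q b : ℕ} (k : Fin (q + 1)) (I : Fin k → Fin m × MultiIdx n b)
    (i : Fin (q - k) → Fin n) (z : JetCoord n m s) : JetCoord n m s [⋀^Fin q]→L[ℝ] ℝ :=
  wedge fun a : Fin q =>
    Fin.append (fun e => contactForm (I e).1 (I e).2.1 z) (fun e => dx (i e))
      (Fin.cast (Nat.add_sub_of_le (Nat.le_of_lt_succ k.2)).symm a)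

/-- The functions `T^{I₁…Iₖ}_{σ₁…σₖ,i_{k+1}…i_q}`, `0 ≤ k ≤ q`, `|I₁|, …, |Iₖ| ≤ b`, of the
coordinates of order at most `s`. -/
abbrev Coeffs (n m s q b : ℕ) : Type :=
  (k : Fin (q + 1)) → (Fin k → Fin m × MultiIdx n b) → (Fin (q - k) → Fin n) →
    JetCoord n m s → ℝ

/-- On `U` the `q`-form `β` has the expression
`∑ₖ ∑_{|I₁|,…,|Iₖ| ≤ b} T^{I₁…Iₖ}_{σ₁…σₖ,i_{k+1}…i_q}
  ω^{σ₁}_{I₁} ∧ ⋯ ∧ ω^{σₖ}_{Iₖ} ∧ dx^{i_{k+1}} ∧ ⋯ ∧ dx^{i_q}`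
with smooth coefficients, antisymmetric in the pairs `(I_a, σ_a)` and in the indices `i_a`. -/
def HasExpression {n m s q b : ℕ} (β : JetCoord n m s → JetCoord n m s [⋀^Fin q]→L[ℝ] ℝ)
    (T : Coeffs n m s q b) (U : Set (JetCoord n m s)) : Prop :=
  (∀ (k : Fin (q + 1)) I i, ContDiffOn ℝ ∞ (T k I i) U) ∧
  (∀ (k : Fin (q + 1)) I i, ∀ (P : Equiv.Perm (Fin k)) (Q : Equiv.Perm (Fin (q - k))), ∀ z ∈ U,
    T k (I ∘ P) (i ∘ Q) z =
      ((Equiv.Perm.sign P : ℤ) : ℝ) * ((Equiv.Perm.sign Q : ℤ) : ℝ) * T k I i z) ∧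
  ∀ z ∈ U, β z = ∑ k : Fin (q + 1), ∑ I, ∑ i, T k I i z • contactMonomial k I i z

/-- `α ∈ Ωˢ_{q,ξ}(X)`: `i_ξ α = 0` for all `ρ^{s,s-1}`-vertical vector fields `ξ`, that is,
`α` vanishes as soon as one argument is a `ρ^{s,s-1}`-vertical tangent vector. -/
def Form.VanishesOnVertical {n m s : ℕ} {X : Type*} [TopologicalSpace X]
    [ChartedSpace (EuclideanSpace ℝ (Fin (n + m))) X] {q : ℕ} (α : Form n m s X q) : Prop :=
  ∀ c : AdaptedChart n m X, ∀ z ∈ c.domain s, ∀ (v : Fin q → JetCoord n m s) (a : Fin q),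
    trunc (Nat.sub_le s 1) (v a) = 0 → α.inChart c z v = 0

/-- `α ∈ Ω^{s,t}_{q,ξ}(X)`: moreover, in the expression of `α` through the contact forms
`ω^σ_I`, `|I| ≤ s - 1`, and the `dxⁱ` in any adapted chart, the coefficients with
`|I₁| + ⋯ + |Iₖ| ≥ t` vanish. -/
def Form.MemOmega {n m s : ℕ} {X : Type*} [TopologicalSpace X]
    [ChartedSpace (EuclideanSpace ℝ (Fin (n + m))) X] {q : ℕ} (α : Form n m s X q)
    (t : ℕ) : Prop :=
  α.VanishesOnVertical ∧ ∀ c : AdaptedChart n m X, ∃ T : Coeffs n m s q (s - 1),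
    HasExpression (α.inChart c) T (c.domain s) ∧
    ∀ (k : Fin (q + 1)) I i, t ≤ ∑ a, ∑ e, (I a).2.1 e → ∀ z ∈ c.domain s, T k I i z = 0

/-- The form `θ` on the open set `U` is `ρ^{s,s-1}`-projectable: it is the pull-back of a smooth
form on the image of `U`. -/
def IsProjectable {n m s q : ℕ} (θ : JetCoord n m s → JetCoord n m s [⋀^Fin q]→L[ℝ] ℝ)
    (U : Set (JetCoord n m s)) : Prop :=
  ∃ θ₀ : JetCoord n m (s - 1) → JetCoord n m (s - 1) [⋀^Fin q]→L[ℝ] ℝ,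
    ContDiffOn ℝ ∞ θ₀ (trunc (Nat.sub_le s 1) '' U) ∧
    ∀ z ∈ U, θ z = (θ₀ (trunc (Nat.sub_le s 1) z)).compContinuousLinearMap
      (trunc (Nat.sub_le s 1))

end Grassmann

end

open scoped Manifold ContDiff Topology

noncomputable section

/-! Put b = r - 1 and regard truncation to order b, or to order s - 1, as a linear projection `cut`
of the coordinate space. Since s ≤ 2r, a product of contact forms of total order below s contains at
most one factor of order ≥ r. All other factors, and the dxⁱ, vanish on vectors vertical over order
b, so α vanishes as soon as two arguments are such vectors (`contactMonomial_eq_zero`).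

The homotopy operator of the retraction onto jets of order b inserts one such vector into α, so its
value vanishes on every such vector. By `extDeriv_homotopyOp` its differential is α minus the
pull-back of α along that retraction. This pull-back is closed, and contraction to a point gives it
a potential that is again zero on these vectors. The sum θ of the two is a potential of α.

The coefficients of θ may still involve coordinates of order s. But α is its own pull-back along the
truncation to order s - 1 (`eq_affinePull`), so θ may be replaced by its pull-back too, which is
projectable (`exists_potential`). Finally, a form killed by all vectors vertical over order b
expands in the contact forms of order ≤ b and the dxⁱ (`exists_hasExpression`). -/

namespace Grassmann

/-! ### Differentiation under the integral sign. -/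

section ParametricIntegral

variable {E F : Type*} [NormedAddCommGroup E] [NormedSpace ℝ E] [FiniteDimensional ℝ E]
  [NormedAddCommGroup F] [NormedSpace ℝ F]

theorem hasFDerivAt_intervalIntegral {g : E × ℝ → F} (hg : ContDiff ℝ 1 g) (a b : ℝ) (x : E) :
    HasFDerivAt (fun x => ∫ t in a..b, g (x, t))
      (∫ t in a..b, (fderiv ℝ g (x, t)).comp (.inl ℝ E ℝ)) x := by
  have : ProperSpace E := FiniteDimensional.proper ℝ E
  have hc : Continuous fun y : E × ℝ => (fderiv ℝ g y).comp (.inl ℝ E ℝ) :=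
    (hg.continuous_fderiv one_ne_zero).clm_comp continuous_const
  obtain ⟨C, hC⟩ := ((isCompact_closedBall x 1).prod (isCompact_uIcc (a := a) (b := b)))
    |>.exists_bound_of_continuousOn hc.continuousOn
  refine intervalIntegral.hasFDerivAt_integral_of_dominated_of_fderiv_le (bound := fun _ => C)
    (F := fun x t => g (x, t)) (F' := fun x t => (fderiv ℝ g (x, t)).comp (.inl ℝ E ℝ))
    (Metric.closedBall_mem_nhds x one_pos) (.of_forall fun y => ?_) ?_ ?_ ?_ ?_ ?_
  · exact (hg.continuous.comp (by fun_prop)).aestronglyMeasurable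
  · exact (hg.continuous.comp (by fun_prop)).intervalIntegrable _ _
  · exact (hc.comp (by fun_prop)).aestronglyMeasurable
  · exact .of_forall fun t ht y hy => hC (y, t) ⟨hy, Set.uIoc_subset_uIcc ht⟩
  · exact intervalIntegrable_const
  · exact .of_forall fun t _ y _ =>
      ((hg.differentiable one_ne_zero) (y, t)).hasFDerivAt.comp y (hasFDerivAt_prodMk_left y t)

/-- The exterior derivative evaluated on fixed vectors is a functional `Λ` of the derivative; this
moves it under the integral. -/
theorem map_fderiv_intervalIntegral [CompleteSpace F] {g : E × ℝ → F} (hg : ContDiff ℝ 1 g)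
    (a b : ℝ) (x : E) (Λ : (E →L[ℝ] F) →L[ℝ] ℝ) :
    (Continuous fun t => Λ (fderiv ℝ (fun x => g (x, t)) x)) ∧
      Λ (fderiv ℝ (fun x => ∫ t in a..b, g (x, t)) x) =
        ∫ t in a..b, Λ (fderiv ℝ (fun x => g (x, t)) x) := by
  have hc : Continuous fun t : ℝ => (fderiv ℝ g (x, t)).comp (.inl ℝ E ℝ) :=
    ((hg.continuous_fderiv one_ne_zero).comp
      (by fun_prop : Continuous fun t : ℝ => (x, t))).clm_comp continuous_const
  have hd : ∀ t, fderiv ℝ (fun x => g (x, t)) x = (fderiv ℝ g (x, t)).comp (.inl ℝ E ℝ) :=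
    fun t => (HasFDerivAt.comp (g := g) (f := fun x => (x, t)) x
      ((hg.differentiable one_ne_zero) (x, t)).hasFDerivAt (hasFDerivAt_prodMk_left x t)).fderiv
  simp only [hd]
  refine ⟨Λ.continuous.comp hc, ?_⟩
  rw [(hasFDerivAt_intervalIntegral hg a b x).fderiv,
    ← Λ.intervalIntegral_comp_comm (hc.intervalIntegrable a b)]

end ParametricIntegral

/-- Induction on the order of smoothness. The step replaces `F` by `E →L[ℝ] F`, so both spaces are
kept in one universe. -/
theorem contDiff_intervalIntegral {E F : Type} [NormedAddCommGroup E] [NormedSpace ℝ E]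
    [FiniteDimensional ℝ E] [NormedAddCommGroup F] [NormedSpace ℝ F] {g : E × ℝ → F}
    (hg : ContDiff ℝ ∞ g) (a b : ℝ) : ContDiff ℝ ∞ fun x => ∫ t in a..b, g (x, t) := by
  refine contDiff_infty.2 fun k => ?_
  induction k generalizing F with
  | zero =>
    exact contDiff_zero.2 <| continuous_iff_continuousAt.2 fun x =>
      (hasFDerivAt_intervalIntegral (hg.of_le (by simp)) a b x).continuousAt
  | succ k ih =>
    push_cast
    exact contDiff_succ_iff_hasFDerivAt.2 ⟨_,
      ih (g := fun y => (fderiv ℝ g y).comp (.inl ℝ E ℝ))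
        ((hg.fderiv_right (by simp)).clm_comp contDiff_const),
      fun x => hasFDerivAt_intervalIntegral (hg.of_le (by simp)) a b x⟩

/-! ### Expansion of alternating forms in exterior products. -/

section WedgeExpansion

variable {E : Type*} [NormedAddCommGroup E] [NormedSpace ℝ E] {q : ℕ}

theorem wedge_apply (l : Fin q → E →L[ℝ] ℝ) (v : Fin q → E) :
    wedge l v = ∑ P : Equiv.Perm (Fin q), ((Equiv.Perm.sign P : ℤ) : ℝ) * ∏ a, l a (v (P a)) := by
  simp [wedge, ContinuousMultilinearMap.alternatization_apply_apply, Units.smul_def]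

theorem wedge_comp_perm (l : Fin q → E →L[ℝ] ℝ) (P : Equiv.Perm (Fin q)) :
    wedge (l ∘ P) = ((Equiv.Perm.sign P : ℤ) : ℝ) • wedge l := by
  ext v
  rw [wedge_apply, ContinuousAlternatingMap.smul_apply, wedge_apply, smul_eq_mul, Finset.mul_sum,
    ← Equiv.sum_comp (Equiv.mulRight P)]
  refine Finset.sum_congr rfl fun Q _ => ?_
  have : ∏ a, (l ∘ P) a (v ((Equiv.mulRight P) Q a)) = ∏ a, l a (v (Q a)) := by
    exact Equiv.prod_comp P fun a => l a (v (Q a))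
  rw [this]
  simp
  ring

theorem apply_eq_sum_apply_comp {κ : Type*} [Fintype κ] (l : κ → E →L[ℝ] ℝ) (e : κ → E)
    (θ : E [⋀^Fin q]→L[ℝ] ℝ) (v : Fin q → E) (h : θ v = θ fun a => ∑ b, l b (v a) • e b) :
    θ v = ∑ f : Fin q → κ, (∏ a, l (f a) (v a)) * θ (e ∘ f) := by
  classical
  rw [h, ContinuousAlternatingMap.map_sum]
  exact Finset.sum_congr rfl fun f _ =>
    θ.map_smul_univ (fun a => l (f a) (v a)) (fun a => e (f a))

theorem map_comp_perm (θ : E [⋀^Fin q]→L[ℝ] ℝ) (v : Fin q → E) (P : Equiv.Perm (Fin q)) :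
    θ (v ∘ P) = ((Equiv.Perm.sign P : ℤ) : ℝ) * θ v := by
  rw [← zsmul_eq_mul, ← Units.smul_def]
  exact θ.toAlternatingMap.map_perm v P

/-- An alternating form which only depends on the components `∑ l_b(v) e_b` of its arguments is
a combination of exterior products of the `l_b`. -/
theorem eq_sum_wedge {κ : Type*} [Fintype κ] (l : κ → E →L[ℝ] ℝ) (e : κ → E)
    (θ : E [⋀^Fin q]→L[ℝ] ℝ) (h : ∀ v, θ v = θ fun a => ∑ b, l b (v a) • e b) :
    θ = ∑ f : Fin q → κ, ((q.factorial : ℝ)⁻¹ * θ (e ∘ f)) • wedge (l ∘ f) := by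
  classical
  ext v
  -- Antisymmetrising multiplies θ by q! and turns the plain products of the multilinear expansion
  -- into wedges.
  have h1 : ∑ P : Equiv.Perm (Fin q), ((Equiv.Perm.sign P : ℤ) : ℝ) * θ (v ∘ P) =
      q.factorial * θ v := by
    have : ∀ P : Equiv.Perm (Fin q), ((Equiv.Perm.sign P : ℤ) : ℝ) * θ (v ∘ P) = θ v := by
      intro P
      rw [map_comp_perm, ← mul_assoc, ← Int.cast_mul, ← Units.val_mul, Int.units_mul_self]
      simp
    simp [this, Fintype.card_perm]
  have hq : (q.factorial : ℝ) ≠ 0 := by positivity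
  rw [← mul_right_inj' hq, ← h1, ContinuousAlternatingMap.sum_apply, Finset.mul_sum]
  simp only [ContinuousAlternatingMap.smul_apply, wedge_apply, smul_eq_mul, Finset.mul_sum]
  rw [Finset.sum_comm]
  refine Finset.sum_congr rfl fun P _ => ?_
  rw [apply_eq_sum_apply_comp l e θ _ (h _), Finset.mul_sum]
  refine Finset.sum_congr rfl fun f _ => ?_
  simp only [Function.comp_apply]
  field_simp

/-- In finite dimension a form is a finite combination of constant wedges whose coefficients are its
values on basis vectors. -/
theorem contDiff_form {E' : Type*} [NormedAddCommGroup E'] [NormedSpace ℝ E']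
    [FiniteDimensional ℝ E] {N : WithTop ℕ∞} {θ : E' → E [⋀^Fin q]→L[ℝ] ℝ}
    (h : ∀ v, ContDiff ℝ N fun z => θ z v) : ContDiff ℝ N θ := by
  have b := Module.finBasis ℝ E
  have : θ = fun z => ∑ f : Fin q → Fin (Module.finrank ℝ E),
      ((q.factorial : ℝ)⁻¹ * θ z (b ∘ f)) •
        wedge ((fun i => LinearMap.toContinuousLinearMap (b.coord i)) ∘ f) := by
    funext z
    refine eq_sum_wedge _ b (θ z) fun v => congrArg (θ z) (funext fun a => ?_)
    simp [b.sum_repr]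
  rw [this]
  exact ContDiff.sum fun f _ => (contDiff_const.mul (h _)).smul contDiff_const

theorem contDiff_form_apply {E' : Type*} [NormedAddCommGroup E'] [NormedSpace ℝ E']
    [FiniteDimensional ℝ E] {N : WithTop ℕ∞} {θ : E' → E [⋀^Fin q]→L[ℝ] ℝ} {v : Fin q → E' → E}
    (hθ : ContDiff ℝ N θ) (hv : ∀ a, ContDiff ℝ N (v a)) :
    ContDiff ℝ N fun z => θ z fun a => v a z := by
  have b := Module.finBasis ℝ E
  have : (fun z => θ z fun a => v a z) = fun z => ∑ f : Fin q → Fin (Module.finrank ℝ E),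
      (∏ a, LinearMap.toContinuousLinearMap (b.coord (f a)) (v a z)) * θ z (b ∘ f) := by
    funext z
    refine apply_eq_sum_apply_comp (fun i => LinearMap.toContinuousLinearMap (b.coord i)) b (θ z) _
      (congrArg (θ z) (funext fun a => ?_))
    simp [b.sum_repr]
  rw [this]
  refine ContDiff.sum fun f _ => (contDiff_prod fun a _ =>
    (ContinuousLinearMap.contDiff _).comp (hv a)).mul ?_
  exact (ContinuousAlternatingMap.apply ℝ E ℝ (b ∘ f)).contDiff.comp hθ

end WedgeExpansion

/-! ### The homotopy operator of a linear retraction. -/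

section Homotopy

variable {E : Type} [NormedAddCommGroup E] [NormedSpace ℝ E] {q : ℕ}

/-- The segment `t ↦ (1 - t) p + t` of linear maps joining `p` to the identity. -/
def segLin (p : E →L[ℝ] E) (t : ℝ) : E →L[ℝ] E := p + t • (ContinuousLinearMap.id ℝ E - p)

theorem segLin_apply (p : E →L[ℝ] E) (t : ℝ) (v : E) : segLin p t v = p v + t • (v - p v) := rfl

/-- The integrand of the homotopy operator of the retraction `z ↦ z₀ + p (z - z₀)`. -/
def homotopyIntegrand (p : E →L[ℝ] E) (z₀ : E) (α : E → E [⋀^Fin (q + 1)]→L[ℝ] ℝ) (y : E × ℝ) :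
    E [⋀^Fin q]→L[ℝ] ℝ :=
  ((α (z₀ + segLin p y.2 (y.1 - z₀))).curryLeft (y.1 - z₀ - p (y.1 - z₀))).compContinuousLinearMap
    (segLin p y.2)

/-- The homotopy operator of the retraction `z ↦ z₀ + p (z - z₀)`. -/
def homotopyOp (p : E →L[ℝ] E) (z₀ : E) (α : E → E [⋀^Fin (q + 1)]→L[ℝ] ℝ) (z : E) :
    E [⋀^Fin q]→L[ℝ] ℝ :=
  ∫ t in (0 : ℝ)..1, homotopyIntegrand p z₀ α (z, t)

/-- Cartan's formula for the family z ↦ z₀ + `segLin p t` (z - z₀), whose velocity is z - z₀ - p (z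
- z₀). The terms differentiating α transversally cancel between the two summands; what remains is
the product rule in t. -/
theorem extDeriv_homotopyIntegrand (p : E →L[ℝ] E) (z₀ : E)
    {α : E → E [⋀^Fin (q + 1)]→L[ℝ] ℝ} (hα : Differentiable ℝ α) (z : E) (t : ℝ)
    (hd : DifferentiableAt ℝ (fun z => homotopyIntegrand p z₀ α (z, t)) z)
    (v : Fin (q + 1) → E) :
    HasDerivAt (fun t => α (z₀ + segLin p t (z - z₀)) fun a => segLin p t (v a))
      (extDeriv (fun z => homotopyIntegrand p z₀ α (z, t)) z v +
        extDeriv α (z₀ + segLin p t (z - z₀))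
          (Fin.cons (z - z₀ - p (z - z₀)) fun a => segLin p t (v a))) t := by
  have hseg : ∀ u : E, HasDerivAt (fun t => segLin p t u) (u - p u) t := fun u => by
    simpa [segLin_apply] using ((hasDerivAt_id t).smul_const (u - p u)).const_add (p u)
  have h1 := (HasFDerivAt.continuousAlternatingMap_apply
    ((hα _).hasFDerivAt.comp t ((hseg (z - z₀)).const_add z₀).hasFDerivAt)
    (fun a => (hseg (v a)).hasFDerivAt)).hasDerivAt
  -- The integrand depends on z through the base point of α and through the inserted velocity, hence
  -- two terms.
  have h2 : ∀ i : Fin (q + 1),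
      fderiv ℝ (fun z => homotopyIntegrand p z₀ α (z, t) (i.removeNth v)) z (v i) =
      fderiv ℝ α (z₀ + segLin p t (z - z₀)) (segLin p t (v i))
        (Fin.cons (z - z₀ - p (z - z₀)) fun a => segLin p t (i.removeNth v a)) +
      α (z₀ + segLin p t (z - z₀))
        (Fin.cons (v i - p (v i)) fun a => segLin p t (i.removeNth v a)) := by
    intro i
    have hsub : HasFDerivAt (fun z => z - z₀) (.id ℝ E) z := (hasFDerivAt_id z).sub_const z₀
    have hw : HasFDerivAt (fun z => z - z₀ - p (z - z₀)) (.id ℝ E - p ∘L .id ℝ E) z :=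
      hsub.sub (p.hasFDerivAt.comp z hsub)
    have hg : ∀ a : Fin (q + 1), HasFDerivAt (fun z => (Fin.cons (z - z₀ - p (z - z₀))
          fun a => segLin p t (i.removeNth v a) : Fin (q + 1) → E) a)
        ((Fin.cons (.id ℝ E - p ∘L .id ℝ E) fun _ => 0 : Fin (q + 1) → E →L[ℝ] E) a) z :=
      Fin.cases hw fun a => hasFDerivAt_const _ _
    have := (HasFDerivAt.continuousAlternatingMap_apply ((hα _).hasFDerivAt.comp z
      (((segLin p t).hasFDerivAt.comp z hsub).const_add z₀)) hg).fderiv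
    rw [show (fun z => homotopyIntegrand p z₀ α (z, t) (i.removeNth v)) = fun z =>
      α (z₀ + segLin p t (z - z₀)) (Fin.cons (z - z₀ - p (z - z₀)) fun a =>
        segLin p t (i.removeNth v a)) from rfl]
    erw [this]
    rw [add_apply, sum_apply, Fin.sum_univ_succ, Finset.sum_eq_zero fun a _ => by simp, add_zero]
    exact congrArg₂ _ rfl (congrArg _ (Fin.update_cons_zero _ _ _))
  refine h1.congr_deriv ?_
  symm
  rw [extDeriv_apply hd, extDeriv, ContinuousAlternatingMap.alternatizeUncurryFin_apply]
  simp only [h2]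
  -- Moving v i - p (v i) from slot 0 to slot i costs the sign (-1)^i and gives the t-derivative of
  -- the i-th argument.
  have h3 : ∀ i : Fin (q + 1),
      (-1 : ℤ) ^ (i : ℕ) • α (z₀ + segLin p t (z - z₀))
        (Fin.cons (v i - p (v i)) fun a => segLin p t (i.removeNth v a)) =
      α (z₀ + segLin p t (z - z₀))
        (Function.update (fun a => segLin p t (v a)) i (v i - p (v i))) := by
    intro i
    have := (α (z₀ + segLin p t (z - z₀))).toAlternatingMap.map_insertNth i (v i - p (v i))
      (fun a => segLin p t (i.removeNth v a))
    refine this.symm.trans (congrArg _ ?_)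
    rw [← Fin.insertNth_removeNth]
    rfl
  simp only [smul_add, Finset.sum_add_distrib, h3, Fin.sum_univ_succ (n := q + 1)]
  have h4 : ∀ i : Fin (q + 1), (i.succ.removeNth (Fin.cons (z - z₀ - p (z - z₀)) fun a =>
      segLin p t (v a) : Fin (q + 2) → E)) =
      Fin.cons (z - z₀ - p (z - z₀)) fun a => segLin p t (i.removeNth v a) := fun i => by
    ext a
    refine Fin.cases rfl (fun a => ?_) a
    simp [Fin.removeNth]
  simp only [h4, Fin.cons_succ, Fin.val_succ, pow_succ, mul_neg_one, neg_smul,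
    Finset.sum_neg_distrib]
  rw [add_apply, sum_apply]
  simp only [Fin.cons_zero, Fin.val_zero, pow_zero, one_smul, Fin.removeNth_zero, Fin.tail_cons,
    ContinuousLinearMap.comp_apply, ContinuousLinearMap.toSpanSingleton_apply,
    ContinuousAlternatingMap.apply_apply, Function.comp_apply]
  have h5 : ∀ (i : Fin (q + 1)) (u : E), (α (z₀ + segLin p t (z - z₀))).toContinuousLinearMap
      (fun a => segLin p t (v a)) i u = α (z₀ + segLin p t (z - z₀))
        (Function.update (fun a => segLin p t (v a)) i u) := fun _ _ => rfl
  simp only [h5]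
  abel

variable [FiniteDimensional ℝ E]

theorem contDiff_homotopyIntegrand (p : E →L[ℝ] E) (z₀ : E)
    {α : E → E [⋀^Fin (q + 1)]→L[ℝ] ℝ} (hα : ContDiff ℝ ∞ α) :
    ContDiff ℝ ∞ (homotopyIntegrand p z₀ α) := by
  have hseg : ∀ f : E × ℝ → E, ContDiff ℝ ∞ f → ContDiff ℝ ∞ fun y => segLin p y.2 (f y) :=
    fun f hf => by
      simp only [segLin_apply]
      exact (p.contDiff.comp hf).add (contDiff_snd.smul (hf.sub (p.contDiff.comp hf)))
  have hsub : ContDiff ℝ ∞ fun y : E × ℝ => y.1 - z₀ := contDiff_fst.sub contDiff_const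
  refine contDiff_form fun v => ?_
  have h := contDiff_form_apply (θ := fun y : E × ℝ => α (z₀ + segLin p y.2 (y.1 - z₀)))
    (v := Fin.cons (fun y => y.1 - z₀ - p (y.1 - z₀)) fun a y => segLin p y.2 (v a))
    (hα.comp (contDiff_const.add (hseg _ hsub)))
    (Fin.cases (hsub.sub (p.contDiff.comp hsub)) fun a => hseg _ contDiff_const)
  convert h using 2 with y
  exact congrArg (α (z₀ + segLin p y.2 (y.1 - z₀)))
    (funext fun a => Fin.cases rfl (fun a => rfl) a)

theorem contDiff_homotopyOp (p : E →L[ℝ] E) (z₀ : E)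
    {α : E → E [⋀^Fin (q + 1)]→L[ℝ] ℝ} (hα : ContDiff ℝ ∞ α) :
    ContDiff ℝ ∞ (homotopyOp p z₀ α) :=
  contDiff_intervalIntegral (contDiff_homotopyIntegrand p z₀ hα) 0 1

theorem homotopyOp_apply (p : E →L[ℝ] E) (z₀ : E)
    {α : E → E [⋀^Fin (q + 1)]→L[ℝ] ℝ} (hα : ContDiff ℝ ∞ α) (z : E) (v : Fin q → E) :
    homotopyOp p z₀ α z v = ∫ t in (0 : ℝ)..1, α (z₀ + segLin p t (z - z₀))
      (Fin.cons (z - z₀ - p (z - z₀)) fun a => segLin p t (v a)) :=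
  ((ContinuousAlternatingMap.apply ℝ E ℝ v).intervalIntegral_comp_comm
    (((contDiff_homotopyIntegrand p z₀ hα).continuous.comp
      (by fun_prop : Continuous fun t : ℝ => (z, t))).intervalIntegrable 0 1)).symm

/-- The homotopy formula for a form which is closed along the segment from `z₀ + p (z - z₀)`
to `z`. -/
theorem extDeriv_homotopyOp (p : E →L[ℝ] E) (z₀ : E)
    {α : E → E [⋀^Fin (q + 1)]→L[ℝ] ℝ} (hα : ContDiff ℝ ∞ α) (z : E)
    (hclosed : ∀ t ∈ Set.Icc (0 : ℝ) 1, extDeriv α (z₀ + segLin p t (z - z₀)) = 0) :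
    extDeriv (homotopyOp p z₀ α) z =
      α z - (α (z₀ + p (z - z₀))).compContinuousLinearMap p := by
  have hK := contDiff_homotopyIntegrand p z₀ hα
  ext v
  let Λ : (E →L[ℝ] E [⋀^Fin q]→L[ℝ] ℝ) →L[ℝ] ℝ := (ContinuousAlternatingMap.apply ℝ E ℝ v).comp
    (ContinuousAlternatingMap.alternatizeUncurryFinCLM ℝ E ℝ)
  obtain ⟨hc, hΛ⟩ := map_fderiv_intervalIntegral (hK.of_le (by simp)) 0 1 z Λ
  have h1 : extDeriv (homotopyOp p z₀ α) z v =
      ∫ t in (0 : ℝ)..1, extDeriv (fun z => homotopyIntegrand p z₀ α (z, t)) z v := hΛ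
  rw [h1, intervalIntegral.integral_eq_sub_of_hasDerivAt
    (f := fun t => α (z₀ + segLin p t (z - z₀)) fun a => segLin p t (v a))]
  · simp [segLin_apply, Function.comp_def]
  · intro t ht
    rw [Set.uIcc_of_le zero_le_one] at ht
    have h := extDeriv_homotopyIntegrand p z₀ (hα.differentiable (by simp)) z t
      (HasFDerivAt.comp (g := homotopyIntegrand p z₀ α) (f := fun z => (z, t)) z
        ((hK.differentiable (by simp)) (z, t)).hasFDerivAt
        (hasFDerivAt_prodMk_left z t)).differentiableAt v
    rwa [hclosed t ht, ContinuousAlternatingMap.coe_zero, Pi.zero_apply, add_zero] at h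
  · exact hc.intervalIntegrable 0 1

end Homotopy

/-! ### Sorting the factors into contact forms and dxⁱ. -/

section Regrouping

/-- The sequence `I₁, …, Iₖ, i_{k+1}, …, i_q`. -/
def mixedSeq {A C : Type*} {q k : ℕ} (hk : k ≤ q) (I : Fin k → A) (i : Fin (q - k) → C)
    (a : Fin q) : A ⊕ C :=
  Fin.append (Sum.inl ∘ I) (Sum.inr ∘ i) (Fin.cast (Nat.add_sub_of_le hk).symm a)

/-- The positions `1, …, k` and `k + 1, …, q`. -/
def splitFin {q k : ℕ} (hk : k ≤ q) : Fin k ⊕ Fin (q - k) ≃ Fin q :=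
  finSumFinEquiv.trans (finCongr (Nat.add_sub_of_le hk))

theorem mixedSeq_splitFin {A C : Type*} {q k : ℕ} (hk : k ≤ q) (I : Fin k → A)
    (i : Fin (q - k) → C) (x : Fin k ⊕ Fin (q - k)) :
    mixedSeq hk I i (splitFin hk x) = Sum.map I i x := by
  rcases x with x | x <;> simp [mixedSeq, splitFin]

/-- Permuting within each block is a single permutation of all positions; this yields the two
antisymmetries of the coefficients. -/
theorem mixedSeq_comp_perm {A C : Type*} {q k : ℕ} (hk : k ≤ q) (I : Fin k → A)
    (i : Fin (q - k) → C) (P : Equiv.Perm (Fin k)) (Q : Equiv.Perm (Fin (q - k))) :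
    mixedSeq hk (I ∘ P) (i ∘ Q) =
      mixedSeq hk I i ∘ (splitFin hk).permCongr (Equiv.Perm.sumCongr P Q) := by
  funext a
  obtain ⟨x, rfl⟩ := (splitFin hk).surjective a
  rcases x with x | x <;> simp [mixedSeq_splitFin, Equiv.permCongr_apply]

/-- Group the sequences by the set S of positions holding an element of `A`. By invariance the
partial sum depends only on k = |S|, and there are `q.choose k` such sets. -/
theorem sum_eq_sum_mixedSeq {A C M : Type*} [Fintype A] [Fintype C] [AddCommMonoid M] {q : ℕ}
    (F : (Fin q → A ⊕ C) → M) (hF : ∀ f (P : Equiv.Perm (Fin q)), F (f ∘ P) = F f) :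
    ∑ f, F f = ∑ k : Fin (q + 1), ∑ I, ∑ i,
      q.choose k • F (mixedSeq (Nat.le_of_lt_succ k.2) I i) := by
  classical
  let g : ℕ → M := fun k => if hk : k ≤ q then
    ∑ I : Fin k → A, ∑ i : Fin (q - k) → C, F (mixedSeq hk I i) else 0
  have key : ∀ S : Finset (Fin q),
      ∑ f with Finset.univ.filter (fun a => (f a).isLeft) = S, F f = g S.card := by
    intro S
    have hS : S.card ≤ q := by simpa using S.card_le_univ
    let e : Fin S.card ⊕ Fin (q - S.card) ≃ Fin q :=
      finSumEquivOfFinset (s := S) rfl (by simp [Finset.card_compl])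
    have el : ∀ x, e (Sum.inl x) ∈ S := fun x => by simp [e]
    have er : ∀ x, e (Sum.inr x) ∉ S := fun x => by
      rw [← Finset.mem_compl]; 
      simp only [e, finSumEquivOfFinset_inr]
      exact Finset.orderEmbOfFin_mem _ _ _
    simp only [g, dif_pos hS]
    rw [← Fintype.sum_prod_type']
    symm
    refine Finset.sum_bij (fun x _ => Sum.map x.1 x.2 ∘ e.symm) ?_ ?_ ?_ ?_
    · intro x _
      simp only [Finset.mem_filter, Finset.mem_univ, true_and]
      ext a
      obtain ⟨y, rfl⟩ := e.surjective a
      rcases y with y | y <;> simp [el, er]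
    · intro x _ y _ h
      have h' : Sum.map x.1 x.2 = Sum.map y.1 y.2 := by
        simpa [Function.comp_assoc] using congrArg (· ∘ e) h
      refine Prod.ext (funext fun a => ?_) (funext fun a => ?_)
      · simpa using congrFun h' (Sum.inl a)
      · simpa using congrFun h' (Sum.inr a)
    · intro f hf
      simp only [Finset.mem_filter, Finset.mem_univ, true_and] at hf
      have hf' : ∀ a, (f a).isLeft ↔ a ∈ S := fun a => by simpa using Finset.ext_iff.1 hf a
      have hl : ∀ x, (f (e (Sum.inl x))).isLeft := fun x => (hf' _).2 (el x)
      have hr : ∀ x, (f (e (Sum.inr x))).isRight := fun x => by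
        simpa using (hf' _).not.2 (er x)
      refine ⟨(fun x => (f (e (Sum.inl x))).getLeft (hl x),
        fun x => (f (e (Sum.inr x))).getRight (hr x)), Finset.mem_univ _, ?_⟩
      funext a
      obtain ⟨y, rfl⟩ := e.surjective a
      rcases y with y | y <;> simp
    · intro x _
      -- This permutation carries S to the first k positions.
      rw [← hF (Sum.map x.1 x.2 ∘ e.symm) ((splitFin hS).symm.trans e)]
      congr 1
      funext a
      obtain ⟨y, rfl⟩ := (splitFin hS).surjective a
      simp [mixedSeq_splitFin]
  rw [← Finset.sum_fiberwise (s := Finset.univ) (fun f : Fin q → A ⊕ C =>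
    Finset.univ.filter fun a => (f a).isLeft), Finset.sum_congr rfl fun S _ => key S]
  have h := Finset.sum_powerset_apply_card g (x := (Finset.univ : Finset (Fin q)))
  rw [Finset.powerset_univ, Finset.card_univ, Fintype.card_fin] at h
  rw [h, Finset.sum_range]
  refine Finset.sum_congr rfl fun k _ => ?_
  simp [g, Nat.le_of_lt_succ k.2, Finset.smul_sum]

/-- The components, with respect to a coframe split into `l_a`, `a ∈ A`, and `l_c`, `c ∈ C`, of a
form which only depends on the components of its arguments along the dual frame. -/
theorem eq_sum_wedge_mixedSeq {E A C : Type*} [Fintype A] [Fintype C] [NormedAddCommGroup E]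
    [NormedSpace ℝ E] {q : ℕ} (l : A ⊕ C → E →L[ℝ] ℝ) (e : A ⊕ C → E)
    (θ : E [⋀^Fin q]→L[ℝ] ℝ) (h : ∀ v, θ v = θ fun a => ∑ b, l b (v a) • e b) :
    θ = ∑ k : Fin (q + 1), ∑ I, ∑ i,
      ((q.choose k * (q.factorial : ℝ)⁻¹) * θ (e ∘ mixedSeq (Nat.le_of_lt_succ k.2) I i)) •
        wedge (l ∘ mixedSeq (Nat.le_of_lt_succ k.2) I i) := by
  conv_lhs => rw [eq_sum_wedge l e θ h]
  rw [sum_eq_sum_mixedSeq]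
  · refine Finset.sum_congr rfl fun k _ => Finset.sum_congr rfl fun I _ =>
      Finset.sum_congr rfl fun i _ => ?_
    rw [← Nat.cast_smul_eq_nsmul ℝ, smul_smul, mul_assoc]
  · intro f P
    have h1 : θ (e ∘ f ∘ P) = ((Equiv.Perm.sign P : ℤ) : ℝ) * θ (e ∘ f) :=
      map_comp_perm θ (e ∘ f) P
    rw [h1, show l ∘ f ∘ P = (l ∘ f) ∘ P from rfl, wedge_comp_perm, smul_smul]
    congr 1
    have h2 : ((Equiv.Perm.sign P : ℤ) : ℝ) * ((Equiv.Perm.sign P : ℤ) : ℝ) = 1 := by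
      rw [← Int.cast_mul, ← Units.val_mul, Int.units_mul_self]
      simp
    linear_combination ((q.factorial : ℝ)⁻¹ * θ (e ∘ f)) * h2

end Regrouping

/-! ### Pull-backs along projections, and the potential. -/

section Pull

variable {E E' : Type} [NormedAddCommGroup E] [NormedSpace ℝ E]
  [NormedAddCommGroup E'] [NormedSpace ℝ E'] {q : ℕ}

/-- The pull-back of a form by the affine map `z ↦ z₀ + p (z - w₀)`. -/
def affinePull (p : E' →L[ℝ] E) (w₀ : E') (z₀ : E) (α : E → E [⋀^Fin q]→L[ℝ] ℝ) (z : E') :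
    E' [⋀^Fin q]→L[ℝ] ℝ :=
  (α (z₀ + p (z - w₀))).compContinuousLinearMap p

theorem contDiff_affine (p : E' →L[ℝ] E) (w₀ : E') (z₀ : E) :
    ContDiff ℝ ∞ fun z => z₀ + p (z - w₀) :=
  contDiff_const.add (p.contDiff.comp (contDiff_id.sub contDiff_const))

/-- The map `segLin p t` is a convex combination of p and the identity, neither of which increases
the norm. -/
theorem segLin_mem_ball (p : E →L[ℝ] E) (hp : ∀ v, ‖p v‖ ≤ ‖v‖) {z₀ z : E} {ε : ℝ}
    (hz : z ∈ Metric.ball z₀ ε) {t : ℝ} (ht : t ∈ Set.Icc (0 : ℝ) 1) :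
    z₀ + segLin p t (z - z₀) ∈ Metric.ball z₀ ε := by
  rw [mem_ball_iff_norm] at *
  refine lt_of_le_of_lt ?_ hz
  have h : z₀ + segLin p t (z - z₀) - z₀ = (1 - t) • p (z - z₀) + t • (z - z₀) := by
    rw [segLin_apply]; module
  rw [h]
  calc _ ≤ ‖(1 - t) • p (z - z₀)‖ + ‖t • (z - z₀)‖ := norm_add_le _ _
    _ = (1 - t) * ‖p (z - z₀)‖ + t * ‖z - z₀‖ := by
      rw [norm_smul, norm_smul, Real.norm_of_nonneg (sub_nonneg.2 ht.2), Real.norm_of_nonneg ht.1]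
    _ ≤ (1 - t) * ‖z - z₀‖ + t * ‖z - z₀‖ := by
      gcongr
      exacts [sub_nonneg.2 ht.2, hp _]
    _ = ‖z - z₀‖ := by ring

theorem affine_mem_ball (p : E →L[ℝ] E) (hp : ∀ v, ‖p v‖ ≤ ‖v‖) {z₀ z : E} {ε : ℝ}
    (hz : z ∈ Metric.ball z₀ ε) : z₀ + p (z - z₀) ∈ Metric.ball z₀ ε := by
  simpa [segLin_apply] using segLin_mem_ball p hp hz (t := 0) (by simp)

/-- Expand θ at w + (v - w) multilinearly: every term except θ w has an argument in the kernel. -/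
theorem map_eq_of_ker (p : E →L[ℝ] E') (θ : E [⋀^Fin q]→L[ℝ] ℝ)
    (h : ∀ v a, p (v a) = 0 → θ v = 0) {v w : Fin q → E} (hvw : ∀ a, p (v a) = p (w a)) :
    θ v = θ w := by
  have := θ.map_add_univ w (v - w)
  rw [add_sub_cancel, Finset.sum_eq_single Finset.univ] at this
  · simpa using this
  · intro S _ hS
    obtain ⟨a, ha⟩ : ∃ a, a ∉ S := by simpa [Finset.eq_univ_iff_forall] using hS
    exact h _ a (by simp [ha, hvw])
  · simp

theorem extDeriv_affinePull (p : E' →L[ℝ] E) (w₀ : E') (z₀ : E) {α : E → E [⋀^Fin q]→L[ℝ] ℝ}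
    (hα : ContDiff ℝ ∞ α) (z : E') :
    extDeriv (affinePull p w₀ z₀ α) z =
      (extDeriv α (z₀ + p (z - w₀))).compContinuousLinearMap p := by
  have hd : ∀ z, fderiv ℝ (fun z => z₀ + p (z - w₀)) z = p := fun z =>
    ((p.hasFDerivAt.comp z ((hasFDerivAt_id z).sub_const w₀)).const_add z₀).fderiv
  have h := extDeriv_pullback (x := z) (hα.differentiable (by simp) (z₀ + p (z - w₀)))
    (contDiff_affine p w₀ z₀).contDiffAt
    (by simpa using WithTop.coe_le_coe.2 (le_top : (2 : ℕ∞) ≤ ⊤))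
  simp only [hd] at h
  exact h

variable [FiniteDimensional ℝ E]

theorem homotopyOp_apply_eq_zero (p : E →L[ℝ] E) (z₀ : E) {α : E → E [⋀^Fin (q + 1)]→L[ℝ] ℝ}
    (hα : ContDiff ℝ ∞ α) (z : E) (v : Fin q → E) (h : ∀ t ∈ Set.Icc (0 : ℝ) 1,
      α (z₀ + segLin p t (z - z₀))
        (Fin.cons (z - z₀ - p (z - z₀)) fun a => segLin p t (v a)) = 0) :
    homotopyOp p z₀ α z v = 0 := by
  rw [homotopyOp_apply p z₀ hα, intervalIntegral.integral_congr (g := fun _ => (0 : ℝ))]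
  · simp
  · intro t ht
    rw [Set.uIcc_of_le zero_le_one] at ht
    exact h t ht

theorem contDiff_affinePull [FiniteDimensional ℝ E'] (p : E' →L[ℝ] E) (w₀ : E') (z₀ : E)
    {α : E → E [⋀^Fin q]→L[ℝ] ℝ} (hα : ContDiff ℝ ∞ α) : ContDiff ℝ ∞ (affinePull p w₀ z₀ α) :=
  contDiff_form fun _ => contDiff_form_apply (θ := fun z => α (z₀ + p (z - w₀)))
    (hα.comp (contDiff_affine p w₀ z₀)) fun _ => contDiff_const

/-- A closed form which vanishes whenever one argument lies in `ker p` is, on a ball, the pull-back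
of its restriction to the image of `p`. -/
theorem eq_affinePull (p : E →L[ℝ] E) (hp : ∀ v, ‖p v‖ ≤ ‖v‖) (hpp : ∀ v, p (p v) = p v) {z₀ : E}
    {ε : ℝ} {α : E → E [⋀^Fin (q + 1)]→L[ℝ] ℝ} (hα : ContDiff ℝ ∞ α)
    (hclosed : ∀ z ∈ Metric.ball z₀ ε, extDeriv α z = 0)
    (hker : ∀ z ∈ Metric.ball z₀ ε, ∀ v a, p (v a) = 0 → α z v = 0) {z : E}
    (hz : z ∈ Metric.ball z₀ ε) : α z = affinePull p z₀ z₀ α z := by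
  have h := extDeriv_homotopyOp p z₀ hα z fun t ht => hclosed _ (segLin_mem_ball p hp hz ht)
  -- The inserted vector lies in ker p, so the operator vanishes near z, and so does its exterior
  -- derivative.
  have h0 : homotopyOp p z₀ α =ᶠ[𝓝 z] fun _ => 0 := by
    filter_upwards [Metric.isOpen_ball.mem_nhds hz] with w hw
    ext v
    exact homotopyOp_apply_eq_zero p z₀ hα w v fun t ht =>
      hker _ (segLin_mem_ball p hp hw ht) _ 0 (by simp [hpp])
  rw [h0.extDeriv_eq] at h
  have h1 : extDeriv (fun _ : E => (0 : E [⋀^Fin q]→L[ℝ] ℝ)) z = 0 := by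
    ext v
    simp [extDeriv, ContinuousAlternatingMap.alternatizeUncurryFin_apply]
  rw [h1] at h
  exact (sub_eq_zero.1 h.symm)

/-- A closed form which vanishes whenever one argument lies in `ker p₁` or two arguments lie in
`ker p₂` has, on a ball, a potential which is the pull-back of a form on the image of `p₁` and
vanishes whenever one argument lies in `ker p₂`. -/
theorem exists_potential (p₁ p₂ : E →L[ℝ] E) (hp₁ : ∀ v, ‖p₁ v‖ ≤ ‖v‖)
    (hpp₁ : ∀ v, p₁ (p₁ v) = p₁ v) (hp₂ : ∀ v, ‖p₂ v‖ ≤ ‖v‖) (hpp₂ : ∀ v, p₂ (p₂ v) = p₂ v)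
    (hp₂₁ : ∀ v, p₂ (p₁ v) = p₂ v) {z₀ : E}
    {ε : ℝ} {α : E → E [⋀^Fin (q + 1)]→L[ℝ] ℝ} (hα : ContDiff ℝ ∞ α)
    (hclosed : ∀ z ∈ Metric.ball z₀ ε, extDeriv α z = 0)
    (hker₁ : ∀ z ∈ Metric.ball z₀ ε, ∀ v a, p₁ (v a) = 0 → α z v = 0)
    (hker₂ : ∀ z ∈ Metric.ball z₀ ε, ∀ v a a', a ≠ a' → p₂ (v a) = 0 → p₂ (v a') = 0 →
      α z v = 0) :
    ∃ θ : E → E [⋀^Fin q]→L[ℝ] ℝ, ContDiff ℝ ∞ θ ∧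
      (∀ z ∈ Metric.ball z₀ ε, α z = extDeriv (affinePull p₁ z₀ z₀ θ) z) ∧
      ∀ z ∈ Metric.ball z₀ ε, ∀ v a, p₂ (v a) = 0 → affinePull p₁ z₀ z₀ θ z v = 0 := by
  set β := affinePull p₂ z₀ z₀ α with hβ
  have hβc : ContDiff ℝ ∞ β := contDiff_affinePull p₂ z₀ z₀ hα
  have hθ₁ := contDiff_homotopyOp p₂ z₀ hα
  have hθ₂ := contDiff_homotopyOp 0 z₀ hβc
  have h0 : ∀ v : E, ‖(0 : E →L[ℝ] E) v‖ ≤ ‖v‖ := fun v => by simp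
  have hd : ∀ z ∈ Metric.ball z₀ ε,
      extDeriv (homotopyOp p₂ z₀ α + homotopyOp 0 z₀ β) z = α z := by
    intro z hz
    rw [extDeriv_add (hθ₁.differentiable (by simp) z) (hθ₂.differentiable (by simp) z),
      extDeriv_homotopyOp p₂ z₀ hα z fun t ht => hclosed _ (segLin_mem_ball p₂ hp₂ hz ht),
      extDeriv_homotopyOp 0 z₀ hβc z fun t ht => ?_]
    -- The pull-back by a constant map is zero because the degree q + 1 is positive.
    · have : (β (z₀ + (0 : E →L[ℝ] E) (z - z₀))).compContinuousLinearMap (0 : E →L[ℝ] E) = 0 := by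
        ext v
        exact (β _).map_coord_zero (m := (0 : E →L[ℝ] E) ∘ v) 0 rfl
      rw [this, hβ, affinePull]
      abel
    · rw [hβ, extDeriv_affinePull _ _ _ hα,
        hclosed _ (affine_mem_ball p₂ hp₂ (segLin_mem_ball 0 h0 hz ht))]
      rfl
  have hθ : ContDiff ℝ ∞ (homotopyOp p₂ z₀ α + homotopyOp 0 z₀ β) := hθ₁.add hθ₂
  refine ⟨homotopyOp p₂ z₀ α + homotopyOp 0 z₀ β, hθ, fun z hz => ?_, ?_⟩
  · rw [extDeriv_affinePull _ _ _ hθ, hd _ (affine_mem_ball p₁ hp₁ hz)]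
    exact eq_affinePull p₁ hp₁ hpp₁ hα hclosed hker₁ hz
  · intro z hz v a hv
    have hz' := affine_mem_ball p₁ hp₁ hz
    change homotopyOp p₂ z₀ α (z₀ + p₁ (z - z₀)) (p₁ ∘ v) +
      homotopyOp 0 z₀ β (z₀ + p₁ (z - z₀)) (p₁ ∘ v) = 0
    rw [homotopyOp_apply_eq_zero _ _ hα, homotopyOp_apply_eq_zero _ _ hβc, add_zero]
    · intro t _
      rw [hβ]
      -- β is a pull-back along p₂, so one argument in ker p₂ suffices.
      refine (α _).map_coord_zero (m := p₂ ∘ Fin.cons _ _) a.succ ?_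
      simp [segLin_apply, hp₂₁, hv]
    · intro t ht
      -- Here two arguments lie in ker p₂: the inserted vector, and the given one after transport
      -- along the segment.
      refine hker₂ _ (segLin_mem_ball p₂ hp₂ hz' ht) _ 0 a.succ (Fin.succ_ne_zero a).symm ?_ ?_
      · simp only [Fin.cons_zero, map_sub, hpp₂, sub_self]
      · simp [segLin_apply, hp₂₁, hv]

/-- A form which is smooth near a point agrees near this point with a globally smooth one. -/
theorem exists_contDiff_eq_on_ball {α : E → E [⋀^Fin q]→L[ℝ] ℝ} {D : Set E} (hD : IsOpen D)
    (hα : ContDiffOn ℝ ∞ α D) {z₀ : E} (hz₀ : z₀ ∈ D) :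
    ∃ ε > 0, Metric.ball z₀ ε ⊆ D ∧ ∃ α' : E → E [⋀^Fin q]→L[ℝ] ℝ, ContDiff ℝ ∞ α' ∧
      ∀ z ∈ Metric.ball z₀ ε, α' z = α z := by
  obtain ⟨R, hR, hRD⟩ := Metric.isOpen_iff.1 hD z₀ hz₀
  -- χ is 1 on the ball of radius R/4, and its support, of radius R/2, stays inside `D`.
  let χ : ContDiffBump z₀ := ⟨R / 4, R / 2, by positivity, by linarith⟩
  refine ⟨R / 4, by positivity, (Metric.ball_subset_ball (by linarith)).trans hRD,
    fun z => χ z • α z, contDiff_iff_contDiffAt.2 fun z => ?_, fun z hz => ?_⟩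
  · by_cases hz : z ∈ D
    · exact χ.contDiffAt.smul (hα.contDiffAt (hD.mem_nhds hz))
    · have hz' : z ∉ tsupport χ := by
        rw [χ.tsupport_eq]
        exact fun h => hz (hRD (Metric.closedBall_subset_ball (by simp [χ]; linarith) h))
      have : (fun z => χ z • α z) =ᶠ[𝓝 z] fun _ => 0 := by
        filter_upwards [notMem_tsupport_iff_eventuallyEq.1 hz'] with w hw
        simp [hw]
      exact contDiffAt_const.congr_of_eventuallyEq this
  · simp [χ.one_of_mem_closedBall (Metric.ball_subset_closedBall hz)]

end Pull

/-! ### Truncation of jets, and the contact coframe. -/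

section Jets

variable {n m s r : ℕ}

/-- The extension of `(xⁱ, y^σ_J)_{|J| ≤ r}` by `y^σ_J = 0` for `r < |J| ≤ s`. -/
def extendZero (n m r s : ℕ) : JetCoord n m r →L[ℝ] JetCoord n m s :=
  (ContinuousLinearMap.fst ℝ _ _).prod
    ((ContinuousLinearMap.pi fun a : Fin m × MultiIdx n s =>
      if h : ∑ i, a.2.1 i ≤ r then
        ContinuousLinearMap.proj (R := ℝ) (φ := fun _ : Fin m × MultiIdx n r => ℝ)
          (a.1, (⟨a.2.1, h⟩ : MultiIdx n r))
      else 0).comp (ContinuousLinearMap.snd ℝ _ _))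

theorem extendZero_snd (w : JetCoord n m r) (a : Fin m × MultiIdx n s) :
    (extendZero n m r s w).2 a =
      if h : ∑ i, a.2.1 i ≤ r then w.2 (a.1, ⟨a.2.1, h⟩) else 0 := by
  change (if h : ∑ i, a.2.1 i ≤ r then
        ContinuousLinearMap.proj (R := ℝ) (φ := fun _ : Fin m × MultiIdx n r => ℝ)
          (a.1, (⟨a.2.1, h⟩ : MultiIdx n r))
      else 0 : (Fin m × MultiIdx n r → ℝ) →L[ℝ] ℝ) w.2 = _
  split_ifs <;> rfl

theorem trunc_extendZero (h : r ≤ s) (w : JetCoord n m r) :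
    trunc h (extendZero n m r s w) = w := by
  refine Prod.ext rfl (funext fun a => ?_)
  change (extendZero n m r s w).2 (a.1, ⟨a.2.1, a.2.2.trans h⟩) = _
  rw [extendZero_snd, dif_pos a.2.2]

/-- The truncation to order `r` as an endomorphism. -/
def cut (h : r ≤ s) : JetCoord n m s →L[ℝ] JetCoord n m s := (extendZero n m r s).comp (trunc h)

theorem cut_snd (h : r ≤ s) (v : JetCoord n m s) (a : Fin m × MultiIdx n s) :
    (cut h v).2 a = if ∑ i, a.2.1 i ≤ r then v.2 a else 0 := by
  change (extendZero n m r s (trunc h v)).2 a = _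
  rw [extendZero_snd]
  split_ifs <;> rfl

theorem norm_cut_le (h : r ≤ s) (v : JetCoord n m s) : ‖cut h v‖ ≤ ‖v‖ := by
  refine max_le (le_max_left ‖v.1‖ ‖v.2‖) (le_trans ?_ (le_max_right ‖v.1‖ ‖v.2‖))
  refine (pi_norm_le_iff_of_nonneg (norm_nonneg _)).2 fun a => ?_
  rw [cut_snd]
  split_ifs
  · exact norm_le_pi_norm v.2 a
  · simp

theorem trunc_cut (h : r ≤ s) (v : JetCoord n m s) : trunc h (cut h v) = trunc h v :=
  trunc_extendZero h _

theorem cut_cut (h : r ≤ s) (v : JetCoord n m s) : cut h (cut h v) = cut h v :=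
  congrArg (extendZero n m r s) (trunc_cut h v)

theorem cut_cut_of_le {r' : ℕ} (h : r ≤ s) (h' : r' ≤ s) (hr : r ≤ r') (v : JetCoord n m s) :
    cut h (cut h' v) = cut h v := by
  refine Prod.ext rfl (funext fun a => ?_)
  rw [cut_snd, cut_snd, cut_snd]
  split_ifs with h1 h2
  · rfl
  · exact absurd (h1.trans hr) h2
  · rfl

theorem cut_eq_zero_iff (h : r ≤ s) {v : JetCoord n m s} : cut h v = 0 ↔ trunc h v = 0 := by
  constructor <;> intro hv
  · rw [← trunc_cut, hv, map_zero]
  · change extendZero n m r s (trunc h v) = 0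
    rw [hv, map_zero]

theorem dx_eq_zero_of_trunc (h : r ≤ s) {v : JetCoord n m s} (hv : trunc h v = 0) (i : Fin n) :
    dx i v = 0 :=
  congrFun (congrArg Prod.fst hv) i

theorem dy_eq_zero_of_trunc (h : r ≤ s) {v : JetCoord n m s} (hv : trunc h v = 0) (σ : Fin m)
    {J : Fin n → ℕ} (hJ : ∑ i, J i ≤ r) : dy σ J v = 0 := by
  rw [dy, dif_pos (hJ.trans h)]
  exact congrFun (congrArg Prod.snd hv) (σ, ⟨J, hJ⟩)

/-- The coordinates of order |J| + 1 enter ω^σ_J only as coefficients, not through their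
differentials. -/
theorem contactForm_eq_zero_of_trunc (h : r ≤ s) {v : JetCoord n m s} (hv : trunc h v = 0)
    (σ : Fin m) {J : Fin n → ℕ} (hJ : ∑ i, J i ≤ r) (z : JetCoord n m s) :
    contactForm σ J z v = 0 := by
  simp [contactForm, dx_eq_zero_of_trunc h hv, dy_eq_zero_of_trunc h hv σ hJ]

/-- A product of contact forms of total order less than `2 (r + 1)` and of `dxⁱ` vanishes if two
arguments are vertical over the jets of order `r`. -/
theorem contactMonomial_eq_zero {q b : ℕ} (h : r ≤ s) (k : Fin (q + 1))
    (I : Fin k → Fin m × MultiIdx n b) (i : Fin (q - k) → Fin n) (z : JetCoord n m s)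
    (hI : ∑ a, ∑ e, (I a).2.1 e < 2 * (r + 1)) (v : Fin q → JetCoord n m s) {a a' : Fin q}
    (ha : a ≠ a') (hv : trunc h (v a) = 0) (hv' : trunc h (v a') = 0) :
    contactMonomial k I i z v = 0 := by
  have hk := Nat.le_of_lt_succ k.2
  -- A factor that does not vanish on a vertical vector must be a contact form of order at least r +
  -- 1.
  have key : ∀ (j : Fin q) (w : JetCoord n m s), trunc h w = 0 →
      Fin.append (fun e => contactForm (I e).1 (I e).2.1 z) (fun e => dx (i e))
        (Fin.cast (Nat.add_sub_of_le hk).symm j) w ≠ 0 →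
      ∃ e : Fin k, splitFin hk (Sum.inl e) = j ∧ r + 1 ≤ ∑ c, (I e).2.1 c := by
    intro j w hw hj
    obtain ⟨x, rfl⟩ := (splitFin hk).surjective j
    rcases x with e | e
    · refine ⟨e, rfl, ?_⟩
      by_contra hlt
      refine hj ?_
      simpa [splitFin] using contactForm_eq_zero_of_trunc h hw (I e).1 (by omega) z
    · exact absurd (by simpa [splitFin] using dx_eq_zero_of_trunc h hw (i e)) hj
  rw [contactMonomial, wedge_apply]
  refine Finset.sum_eq_zero fun P _ => mul_eq_zero_of_right _ ?_
  by_contra hne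
  rw [Finset.prod_eq_zero_iff] at hne
  push Not at hne
  obtain ⟨e, he, h1⟩ := key (P.symm a) _ hv (by simpa using hne (P.symm a) (Finset.mem_univ _))
  obtain ⟨e', he', h1'⟩ :=
    key (P.symm a') _ hv' (by simpa using hne (P.symm a') (Finset.mem_univ _))
  have hee : e ≠ e' := by
    rintro rfl
    exact ha (P.symm.injective (he.symm.trans he'))
  -- Two distinct factors of order ≥ r + 1 exceed the allowed total order.
  have := Finset.add_le_sum (s := Finset.univ) (f := fun a => ∑ c, (I a).2.1 c)
    (fun _ _ => Nat.zero_le _) (Finset.mem_univ e) (Finset.mem_univ e') hee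
  omega

/-- The contact forms of order at most `b` and the `dxⁱ`. -/
def contactCoframe {b : ℕ} (z : JetCoord n m s) :
    (Fin m × MultiIdx n b) ⊕ Fin n → JetCoord n m s →L[ℝ] ℝ :=
  Sum.elim (fun a => contactForm a.1 a.2.1 z) dx

/-- Vectors dual to the contact forms of order at most `b` and the `dxⁱ`. -/
def contactFrame {b : ℕ} (hb : b ≤ s) (z : JetCoord n m s) :
    (Fin m × MultiIdx n b) ⊕ Fin n → JetCoord n m s :=
  Sum.elim (fun a => (0, Pi.single (a.1, ⟨a.2.1, a.2.2.trans hb⟩) 1))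
    fun i => (Pi.single i 1, fun a =>
      if ∑ e, a.2.1 e ≤ b then dy a.1 (a.2.1 + Pi.single i 1) z else 0)

theorem contDiff_contactFrame {b : ℕ} (hb : b ≤ s) (a : (Fin m × MultiIdx n b) ⊕ Fin n) :
    ContDiff ℝ ∞ fun z : JetCoord n m s => contactFrame hb z a := by
  rcases a with a | i
  · exact contDiff_const
  · refine contDiff_const.prodMk (contDiff_pi.2 fun a => ?_)
    split_ifs
    · exact ContinuousLinearMap.contDiff _
    · exact contDiff_const

/-- The frame consists of the ∂/∂y^σ_J and of the total derivatives cut off above order b, so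
components along it determine a vector up to vertical ones. -/
theorem trunc_sum_contactFrame {b : ℕ} (hb : b ≤ s) (z v : JetCoord n m s) :
    trunc hb (∑ a, contactCoframe (b := b) z a v • contactFrame hb z a) = trunc hb v := by
  refine Prod.ext (funext fun i => ?_) (funext fun a => ?_)
  · change (∑ a, contactCoframe (b := b) z a v • contactFrame hb z a).1 i = v.1 i
    rw [Prod.fst_sum, Finset.sum_apply, Fintype.sum_sum_type]
    simp [contactCoframe, contactFrame, Pi.single_apply, dx]
  · change (∑ a, contactCoframe (b := b) z a v • contactFrame hb z a).2
      (a.1, ⟨a.2.1, a.2.2.trans hb⟩) = v.2 (a.1, ⟨a.2.1, a.2.2.trans hb⟩)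
    rw [Prod.snd_sum, Finset.sum_apply, Fintype.sum_sum_type, Finset.sum_eq_single a]
    · simp only [contactCoframe, contactFrame, contactForm, Sum.elim_inl, Sum.elim_inr]
      have := a.2.2
      simp [this, dy, this.trans hb, mul_comm]
    · intro c _ hc
      have : ((a.1, ⟨a.2.1, a.2.2.trans hb⟩) : Fin m × MultiIdx n s) ≠
          (c.1, ⟨c.2.1, c.2.2.trans hb⟩) := by
        intro h
        refine hc (Prod.ext (congrArg Prod.fst h).symm (Subtype.ext ?_))
        exact (congrArg (fun x => x.2.1) h).symm
      simp [contactFrame, this]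
    · simp

end Jets

/-- A form which vanishes whenever one argument is vertical over the jets of order `b` has an
expression through the contact forms of order at most `b`. -/
theorem exists_hasExpression {n m s q b : ℕ} (hb : b ≤ s)
    {θ : JetCoord n m s → JetCoord n m s [⋀^Fin q]→L[ℝ] ℝ} (hθ : ContDiff ℝ ∞ θ)
    {U : Set (JetCoord n m s)}
    (hker : ∀ z ∈ U, ∀ v a, trunc hb (v a) = 0 → θ z v = 0) :
    ∃ L : Coeffs n m s q b, HasExpression θ L U := by
  -- The factor 1/q! comes from summing over all sequences, the binomial from the choice of
  -- positions of the contact forms.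
  refine ⟨fun k I i z => (q.choose k * (q.factorial : ℝ)⁻¹) *
    θ z (contactFrame hb z ∘ mixedSeq (Nat.le_of_lt_succ k.2) I i), ?_, ?_, ?_⟩
  · intro k I i
    exact (contDiff_const.mul (contDiff_form_apply hθ
      fun a => contDiff_contactFrame hb _)).contDiffOn
  · intro k I i P Q z _
    simp only
    rw [mixedSeq_comp_perm, ← Function.comp_assoc, map_comp_perm, Equiv.Perm.sign_permCongr,
      Equiv.Perm.sign_sumCongr]
    push_cast
    ring
  · intro z hz
    refine (eq_sum_wedge_mixedSeq (contactCoframe (b := b) z) (contactFrame hb z) (θ z) fun v =>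
      map_eq_of_ker (trunc hb) (θ z) (hker z hz) fun a =>
        (trunc_sum_contactFrame hb z (v a)).symm).trans ?_
    refine Finset.sum_congr rfl fun k _ => Finset.sum_congr rfl fun I _ =>
      Finset.sum_congr rfl fun i _ => congrArg _ (congrArg wedge (funext fun a => ?_))
    obtain ⟨x, rfl⟩ := (splitFin (Nat.le_of_lt_succ k.2)).surjective a
    rw [Function.comp_apply, mixedSeq_splitFin]
    rcases x with x | x <;> simp [splitFin, contactCoframe]

theorem AdaptedChart.isOpen_domain {n m : ℕ} {X : Type*} [TopologicalSpace X]
    [ChartedSpace (EuclideanSpace ℝ (Fin (n + m))) X] (c : AdaptedChart n m X) (s : ℕ) :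
    IsOpen (c.domain s) := by
  refine c.chart.open_target.preimage ((PiLp.continuous_toLp 2 _).comp (continuous_pi fun A => ?_))
  rcases c.split.symm A with i | σ
  · exact (dx i).continuous
  · exact (dy σ 0).continuous

end Grassmann

end

/-! ### The theorem, in an adapted chart. -/

theorem mainTheorem3 {n m s q : ℕ} (hn : 1 ≤ n) (hs : 1 ≤ s)
    {X : Type*} [TopologicalSpace X] [ChartedSpace (EuclideanSpace ℝ (Fin (n + m))) X]
    [IsManifold (𝓡 (n + m)) ∞ X]
    (α : Grassmann.Form n m s X (q + 1)) (hα : α.MemOmega s) (hclosed : α.IsClosed)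
    (c : Grassmann.AdaptedChart n m X) (z₀ : Grassmann.JetCoord n m s)
    (hz₀ : z₀ ∈ c.domain s) :
    ∃ U : Set (Grassmann.JetCoord n m s), IsOpen U ∧ z₀ ∈ U ∧ U ⊆ c.domain s ∧
      ∃ θ : Grassmann.JetCoord n m s → Grassmann.JetCoord n m s [⋀^Fin q]→L[ℝ] ℝ,
        ContDiffOn ℝ ∞ θ U ∧
        (∀ z ∈ U, α.inChart c z = extDeriv θ z) ∧
        Grassmann.IsProjectable θ U ∧
        ∃ L : Grassmann.Coeffs n m s q ((s + 1) / 2 - 1), Grassmann.HasExpression θ L U := by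
  open Grassmann in
  have hb : (s + 1) / 2 - 1 ≤ s := by omega
  obtain ⟨hvert, hexp⟩ := hα
  obtain ⟨T, ⟨-, -, hT⟩, hT0⟩ := hexp c
  -- After a cutoff the homotopy operators apply to a form smooth on the whole coordinate space;
  -- closedness and the kernel conditions are needed only on the ball.
  obtain ⟨ε, hε, hball, α', hα', heq⟩ :=
    exists_contDiff_eq_on_ball (c.isOpen_domain s) (α.smooth c) hz₀
  have hd : ∀ z ∈ Metric.ball z₀ ε, extDeriv α' z = 0 := fun z hz => by
    rw [← hclosed c z (hball hz)]
    refine Filter.EventuallyEq.extDeriv_eq ?_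
    filter_upwards [Metric.isOpen_ball.mem_nhds hz] with w hw using heq w hw
  obtain ⟨θ, hθ, hαθ, hker⟩ := exists_potential (cut (Nat.sub_le s 1)) (cut hb) (norm_cut_le _)
    (cut_cut _) (norm_cut_le _) (cut_cut _) (cut_cut_of_le _ _ (by omega)) hα' hd
    (fun z hz v a hv => by
      rw [heq z hz]
      exact hvert c z (hball hz) v a ((cut_eq_zero_iff _).1 hv))
    (fun z hz v a a' ha hv hv' => by
      rw [heq z hz, hT z (hball hz)]
      simp only [ContinuousAlternatingMap.sum_apply, ContinuousAlternatingMap.smul_apply]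
      refine Finset.sum_eq_zero fun k _ => Finset.sum_eq_zero fun I _ =>
        Finset.sum_eq_zero fun i _ => ?_
      rcases le_or_gt s (∑ a, ∑ e, (I a).2.1 e) with h | h
      · rw [hT0 k I i h z (hball hz), zero_smul]
      -- The arithmetic is s ≤ 2 [(s + 1)/2] = 2 (b + 1).
      · rw [contactMonomial_eq_zero hb k I i z (by omega) v ha ((cut_eq_zero_iff _).1 hv)
          ((cut_eq_zero_iff _).1 hv'), smul_zero])
  have hθ' := contDiff_affinePull (cut (Nat.sub_le s 1)) z₀ z₀ hθ
  refine ⟨Metric.ball z₀ ε, Metric.isOpen_ball, Metric.mem_ball_self hε, hball, _,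
    hθ'.contDiffOn, fun z hz => (heq z hz).symm.trans (hαθ z hz), ?_, ?_⟩
  -- Since `cut` is `extendZero` after `trunc`, the pull-back along `cut` factors through jets of
  -- order s - 1.
  · refine ⟨affinePull (extendZero n m (s - 1) s) (trunc (Nat.sub_le s 1) z₀) z₀ θ,
      (contDiff_affinePull _ _ _ hθ).contDiffOn, fun z _ => ?_⟩
    simp only [affinePull, ← map_sub]
    rfl
  · exact exists_hasExpression hb hθ' fun z hz v a hv =>
      hker z hz v a ((cut_eq_zero_iff hb).2 hv)
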